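/- Fix an integer $r \ge 2$. For each $n$ let $H_n = (V(H_n), E(H_n))$ be an $r$-uniform hypergraph with finitely many hyperedges, that is, $E(H_n)$ is a finite set of $r$-element subsets of $V(H_n)$. Let the vertices of $H_n$ be colored uniformly at random with $c_n$ colors: the colors $X_v$, $v \in V(H_n)$, are independent and $\mathbb{P}(X_v = a) = 1/c_n$ for every $a \in \{1, \dots, c_n\}$. Assume that $c_n \to \infty$. Let $$T(H_n) := \sum_{e \in E(H_n)} \mathbf{1}\{X_v = X_{v'} \text{ for all } v, v' \in e\}$$ be the number of monochromatic hyperedges. If, for some constant $\lambda \ge 0$, $$\lim_{n \to \infty} \mathbb{E}\, T(H_n) = \lambda \quad \text{and} \quad \lim_{n \to \infty} \mathrm{Var}\, T(H_n) = \lambda,$$ then, as $n \to \infty$, $T(H_n)$ converges in distribution to the Poisson distribution with mean $\lambda$ (the point mass at $0$ if $\lambda = 0$). -/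

import Mathlib

/-- A hypergraph is `r`-uniform if each of its hyperedges has exactly `r` vertices. -/
def Hypergraph.IsUniformOfRank {V : Type*} (H : Hypergraph V) (r : ℕ) : Prop :=
  ∀ e ∈ H.edgeSet, e.encard = r

/-- The hyperedge `e` is monochromatic under the coloring `x` of the vertices of `H`:
all vertices of `e` have the same color. -/
def Hypergraph.IsMonochromatic {V C : Type*} (H : Hypergraph V) (x : H.vertexSet → C)
    (e : Set V) : Prop :=
  ∀ v w : H.vertexSet, (v : V) ∈ e → (w : V) ∈ e → x v = x w

/-- The number of monochromatic hyperedges of `H` under the coloring `x` of its vertices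
(meaningful for a hypergraph with finitely many hyperedges). -/
noncomputable def Hypergraph.monochromaticCount {V C : Type*} (H : Hypergraph V)
    (x : H.vertexSet → C) : ℕ :=
  {e | e ∈ H.edgeSet ∧ H.IsMonochromatic x e}.ncard

/-- The random coloring `X` of the vertices of `H` is a uniformly random coloring with `c` colors:
every vertex has each of the `c` colors with probability `1 / c`, independently of the other
vertices. -/
structure Hypergraph.IsUniformRandomColoring {V Ω : Type*} [MeasurableSpace Ω]
    (H : Hypergraph V) (c : ℕ) (P : MeasureTheory.Measure Ω)
    (X : H.vertexSet → Ω → Fin c) : Prop where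
  measurable : ∀ v, Measurable (X v)
  uniform : ∀ (v : H.vertexSet) (a : Fin c), P.real {ω | X v ω = a} = 1 / (c : ℝ)
  indep : ProbabilityTheory.iIndepFun X P

/-! The proof is a Stein argument with a size-bias coupling. Let N be the number of monochromatic
edges, m its mean, and p = c^{-(r-1)} the probability that a given edge is monochromatic.
Conditioning on e being monochromatic amounts to giving all of e the color of a chosen vertex v_e;
let N^e be the count afterwards. Then E[N g(N)] = p ∑_e E[g(N^e)], and with g the indicator of k + 1
the defect in the Poisson recursion (k+1) P(N=k+1) = m P(N=k) is at most p ∑_e E|N^e - N - 1|.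

Two kinds of edges f ≠ e contribute to N^e - N. Edges meeting e in at least two vertices are
controlled by the variance: edges sharing at most one vertex are uncorrelated, while larger
intersections multiply the conditional probability by at least c. Hence Var N - m → 0 forces their
total weight `overlap` to 0 (`overlap_le`).

Edges meeting e only in one vertex other than v_e are invisible to the variance and could be
numerous. Taking v_e of maximal degree in e makes their number summable by Cauchy-Schwarz against
codegrees, which again reduces to pairs with large intersection (`sum_sum_degree_erase_le`).

The asymptotic recursion and bounded means then determine the limit law. -/

namespace RandomColoring

open Finset
open scoped BigOperators

/-- Give every vertex of `S` the color of the vertex `v`. -/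
def recolor {W C : Type*} [DecidableEq W] (S : Finset W) (v : W) (x : W → C) : W → C :=
  fun w => if w ∈ S then x v else x w

/-- The indicator of the event that the coloring `x` is constant on `s`. -/
noncomputable def monoInd {W C : Type*} (s : Finset W) (x : W → C) : ℝ :=
  open Classical in if ∀ v ∈ s, ∀ w ∈ s, x v = x w then 1 else 0

/-! ### Recoloring a set as conditioning on its being monochromatic -/

section Recolor

variable {W C : Type*}

lemma monoInd_nonneg (s : Finset W) (x : W → C) : 0 ≤ monoInd s x := by
  unfold monoInd; split_ifs <;> norm_num

lemma monoInd_congr {s : Finset W} {x y : W → C} (h : ∀ w ∈ s, x w = y w) :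
    monoInd s x = monoInd s y := by
  unfold monoInd
  congr 1
  refine propext (forall₂_congr fun v hv => forall₂_congr fun w hw => ?_)
  rw [h v hv, h w hw]

variable [DecidableEq W]

lemma monoInd_eq_ite [DecidableEq C] {s : Finset W} {v : W} (hv : v ∈ s) (x : W → C) :
    monoInd s x = if ∀ w ∈ s.erase v, x w = x v then 1 else 0 := by
  unfold monoInd
  congr 1
  refine propext ⟨fun h w hw => h w (mem_of_mem_erase hw) v hv, fun h => ?_⟩
  have h' : ∀ w ∈ s, x w = x v := fun w hw => by
    by_cases e : w = v
    · rw [e]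
    · exact h w (mem_erase.2 ⟨e, hw⟩)
  intro a ha b hb
  rw [h' a ha, h' b hb]

lemma monoInd_recolor_eq_one {s : Finset W} {v : W} (hv : v ∈ s) (x : W → C) :
    monoInd s (recolor (s.erase v) v x) = 1 := by
  classical
  rw [monoInd_eq_ite hv, if_pos]
  intro w hw
  simp [recolor, hw]

lemma monoInd_recolor_of_disjoint {s t : Finset W} (h : Disjoint s t) (v : W) (x : W → C) :
    monoInd t (recolor s v x) = monoInd t x :=
  monoInd_congr fun w hw => by simp [recolor, disjoint_right.1 h hw]

/-- A common vertex carries the color of `v` after recoloring, so only the vertices of `t` outside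
`s` still impose a condition. -/
lemma monoInd_recolor_of_inter_nonempty [DecidableEq C] {s t : Finset W} {v : W}
    (h : (s ∩ t).Nonempty) (x : W → C) :
    monoInd t (recolor (s.erase v) v x) = if ∀ w ∈ t \ s, x w = x v then 1 else 0 := by
  obtain ⟨u, hu⟩ := h
  obtain ⟨hus, hut⟩ := mem_inter.1 hu
  have hin : ∀ w ∈ s, recolor (s.erase v) v x w = x v := by
    intro w hw
    by_cases e : w = v
    · simp [recolor, e]
    · simp [recolor, e, hw]
  have hout : ∀ w ∉ s, recolor (s.erase v) v x w = x w := by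
    intro w hw
    simp [recolor, hw]
  unfold monoInd
  congr 1
  refine propext ⟨fun h w hw => ?_, fun h => ?_⟩
  · have := h w (mem_sdiff.1 hw).1 u hut
    rwa [hin u hus, hout w (mem_sdiff.1 hw).2] at this
  · have h' : ∀ w ∈ t, recolor (s.erase v) v x w = x v := by
      intro w hw
      by_cases e : w ∈ s
      · exact hin w e
      · rw [hout w e]; exact h w (mem_sdiff.2 ⟨hw, e⟩)
    intro a ha b hb
    rw [h' a ha, h' b hb]

variable [Fintype W] [Fintype C] [DecidableEq C]

/-- Each coloring with `x a = x v` arises from exactly `card C` colorings, one for each overwritten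
color at `a`. -/
lemma sum_update_eq {a v : W} (hav : a ≠ v) (F : (W → C) → ℝ) :
    ∑ x, F (Function.update x a (x v)) =
      Fintype.card C * ∑ x, if x a = x v then F x else 0 := by
  have hL := Fintype.sum_equiv (Equiv.funSplitAt a C)
    (fun x => F (Function.update x a (x v)))
    (fun y => F ((Equiv.funSplitAt a C).symm (y.2 ⟨v, hav.symm⟩, y.2))) (by
      intro x
      congr 1)
  have hR := Fintype.sum_equiv (Equiv.funSplitAt a C)
    (fun x => if x a = x v then F x else 0)
    (fun y => if y.1 = y.2 ⟨v, hav.symm⟩ then F ((Equiv.funSplitAt a C).symm y) else 0) (by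
      intro x
      simp only [Equiv.symm_apply_apply]
      rfl)
  rw [hL, hR, Fintype.sum_prod_type, Fintype.sum_prod_type_right]
  simp [Finset.sum_ite_eq']

lemma sum_recolor_eq (S : Finset W) {v : W} (hv : v ∉ S) (F : (W → C) → ℝ) :
    ∑ x, F (recolor S v x) =
      (Fintype.card C : ℝ) ^ #S * ∑ x, if ∀ w ∈ S, x w = x v then F x else 0 := by
  induction S using Finset.induction_on generalizing F with
  | empty =>
    have h (x : W → C) : recolor ∅ v x = x := by ext w; simp [recolor]
    simp [h]
  | insert a S ha ih =>
    have hav : a ≠ v := fun h => hv (h ▸ mem_insert_self a S)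
    have hvS : v ∉ S := fun h => hv (mem_insert_of_mem h)
    have h1 : ∀ x : W → C, recolor (insert a S) v x =
        Function.update (recolor S v x) a (recolor S v x v) := by
      intro x
      ext w
      by_cases h : w = a
      · subst h; simp [recolor, hvS]
      · simp [recolor, h]
    simp_rw [h1]
    rw [ih hvS (fun y => F (Function.update y a (y v))), card_insert_of_notMem ha, pow_succ,
      mul_assoc]
    have h2 := sum_update_eq hav (fun x : W → C => if ∀ w ∈ S, x w = x v then F x else 0)
    have h3 : ∀ x : W → C, (∀ w ∈ S, Function.update x a (x v) w = Function.update x a (x v) v) ↔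
        ∀ w ∈ S, x w = x v := by
      intro x
      refine forall₂_congr fun w hw => ?_
      rw [Function.update_of_ne (ne_of_mem_of_not_mem hw ha), Function.update_of_ne hav.symm]
    simp_rw [h3] at h2
    rw [h2]
    congr 2
    refine sum_congr rfl fun x _ => ?_
    simp only [forall_mem_insert, ite_and]

lemma expect_ite_mul_eq [Nonempty C] (S : Finset W) {v : W} (hv : v ∉ S) (F : (W → C) → ℝ) :
    𝔼 x, (if ∀ w ∈ S, x w = x v then 1 else 0) * F x =
      ((Fintype.card C : ℝ) ^ #S)⁻¹ * 𝔼 x, F (recolor S v x) := by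
  have hc : (Fintype.card C : ℝ) ≠ 0 := by simp
  rw [Fintype.expect_eq_sum_div_card, Fintype.expect_eq_sum_div_card, sum_recolor_eq S hv]
  simp only [ite_mul, one_mul, zero_mul]
  field_simp

/-- Conditioning on a monochromatic edge amounts to recoloring it. -/
lemma expect_monoInd_mul_eq [Nonempty C] {s : Finset W} {v : W} (hv : v ∈ s)
    (F : (W → C) → ℝ) :
    𝔼 x, monoInd s x * F x =
      ((Fintype.card C : ℝ) ^ (#s - 1))⁻¹ * 𝔼 x, F (recolor (s.erase v) v x) := by
  simp_rw [monoInd_eq_ite hv]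
  rw [← card_erase_of_mem hv, ← expect_ite_mul_eq _ (notMem_erase v s)]
  refine expect_congr rfl fun x _ => ?_
  congr

lemma expect_monoInd [Nonempty C] {s : Finset W} (hs : s.Nonempty) :
    𝔼 x : W → C, monoInd s x = ((Fintype.card C : ℝ) ^ (#s - 1))⁻¹ := by
  obtain ⟨v, hv⟩ := hs
  simpa using expect_monoInd_mul_eq (C := C) hv (fun _ => 1)

lemma expect_monoInd_recolor [Nonempty C] {s t : Finset W} {v : W} (hv : v ∈ s)
    (h : (s ∩ t).Nonempty) :
    𝔼 x : W → C, monoInd t (recolor (s.erase v) v x) = ((Fintype.card C : ℝ) ^ #(t \ s))⁻¹ := by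
  simp_rw [monoInd_recolor_of_inter_nonempty h]
  have hv' : v ∉ t \ s := by simp [hv]
  simpa using expect_ite_mul_eq (C := C) _ hv' (fun _ => 1)

/-- One shared vertex reveals nothing about whether `t` is monochromatic, since the common color is
uniform anyway. Such pairs therefore have zero covariance. -/
lemma expect_monoInd_recolor_of_card_inter_le_one [Nonempty C] {s t : Finset W} {v : W}
    (hv : v ∈ s) (ht : t.Nonempty) (h : #(s ∩ t) ≤ 1) :
    𝔼 x : W → C, monoInd t (recolor (s.erase v) v x) = ((Fintype.card C : ℝ) ^ (#t - 1))⁻¹ := by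
  rcases (s ∩ t).eq_empty_or_nonempty with h0 | h0
  · have hd : Disjoint (s.erase v) t :=
      (disjoint_iff_inter_eq_empty.2 h0).mono_left (erase_subset v s)
    simp_rw [monoInd_recolor_of_disjoint hd]
    exact expect_monoInd ht
  · rw [expect_monoInd_recolor hv h0]
    have h1 : #(s ∩ t) = 1 := le_antisymm h h0.card_pos
    rw [card_sdiff, h1]

/-- Every shared vertex beyond the first saves a factor `card C`; at least one such factor is
available here. -/
lemma expect_monoInd_recolor_of_two_le_card_inter [Nonempty C] {s t : Finset W} {v : W}
    (hv : v ∈ s) (h : 2 ≤ #(s ∩ t)) :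
    Fintype.card C * ((Fintype.card C : ℝ) ^ (#t - 1))⁻¹ ≤
      𝔼 x : W → C, monoInd t (recolor (s.erase v) v x) := by
  have h0 : (s ∩ t).Nonempty := card_pos.1 (by omega)
  have hc : (1 : ℝ) ≤ Fintype.card C := by exact_mod_cast Fintype.card_pos
  have ht : #(s ∩ t) ≤ #t := card_le_card inter_subset_right
  rw [expect_monoInd_recolor hv h0, card_sdiff]
  obtain ⟨m, hm⟩ : ∃ m, #t - 1 = m + 1 := ⟨#t - 2, by omega⟩
  rw [hm, pow_succ', mul_inv, ← mul_assoc, mul_inv_cancel₀ (by positivity), one_mul]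
  exact inv_anti₀ (by positivity) (pow_le_pow_right₀ hc (by omega))

end Recolor

end RandomColoring

/-! ### Degrees and codegrees in a family of sets -/

namespace RandomColoring

open Finset
open scoped BigOperators

/-- The number of sets of the family `A` on which the coloring `x` is constant. -/
noncomputable def monoCount {W C ι : Type*} [Fintype ι] (A : ι → Finset W) (x : W → C) : ℕ :=
  open Classical in #{e | ∀ v ∈ A e, ∀ w ∈ A e, x v = x w}

/-- The number of sets of the family `A` that contain `w`. -/
def degree {W ι : Type*} [DecidableEq W] [Fintype ι] (A : ι → Finset W) (w : W) : ℕ :=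
  #{e | w ∈ A e}

section Family

variable {W C ι : Type*} [Fintype ι]

lemma monoCount_eq_sum (A : ι → Finset W) (x : W → C) :
    (monoCount A x : ℝ) = ∑ e, monoInd (A e) x := by
  classical
  simp [monoCount, monoInd, Finset.sum_boole]

/-- If `a = b + 1` the indicators agree; otherwise the right side is the absolute value of a nonzero
integer. -/
lemma abs_ite_sub_ite_le (a b k : ℕ) :
    |(if a = k + 1 then (1 : ℝ) else 0) - if b = k then 1 else 0| ≤ |(a : ℝ) - b - 1| := by
  by_cases h : a = b + 1
  · subst h
    simp
  · have h1 : (1 : ℝ) ≤ |(a : ℝ) - b - 1| := by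
      have : (1 : ℤ) ≤ |(a : ℤ) - b - 1| := Int.one_le_abs (by omega)
      exact_mod_cast this
    refine le_trans ?_ h1
    split_ifs <;> norm_num

variable [DecidableEq W]

lemma sum_degree_eq_sum_card_inter (A : ι → Finset W) (s : Finset W) :
    ∑ w ∈ s, degree A w = ∑ e, #(s ∩ A e) := by
  simp_rw [degree, card_filter]
  rw [sum_comm]
  simp

lemma exists_mem_forall_degree_le (A : ι → Finset W) {s : Finset W} (hs : s.Nonempty) :
    ∃ v ∈ s, ∀ w ∈ s, degree A w ≤ degree A v :=
  exists_max_image s (degree A) hs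

/-- Maximality of `v` replaces each degree by a geometric mean over a pair in `s`. This symmetric
form no longer depends on `v` and can be summed over all edges. -/
lemma sum_degree_erase_le (A : ι → Finset W) {s : Finset W} {v : W} (hv : v ∈ s)
    (hmax : ∀ w ∈ s, degree A w ≤ degree A v) :
    ∑ w ∈ s.erase v, (degree A w : ℝ) ≤
      ∑ z ∈ s.offDiag, √(degree A z.1) * √(degree A z.2) := by
  have hinj : Set.InjOn (fun w => (v, w)) (s.erase v : Set W) := by
    intro a _ b _ h
    simpa using h
  calc ∑ w ∈ s.erase v, (degree A w : ℝ)
      ≤ ∑ w ∈ s.erase v, √(degree A v) * √(degree A w) := by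
        refine sum_le_sum fun w hw => ?_
        have h : √(degree A w : ℝ) ≤ √(degree A v) :=
          Real.sqrt_le_sqrt (by exact_mod_cast hmax w (mem_of_mem_erase hw))
        calc (degree A w : ℝ) = √(degree A w) * √(degree A w) :=
              (Real.mul_self_sqrt (by positivity)).symm
          _ ≤ _ := by gcongr
    _ = ∑ z ∈ (s.erase v).image (fun w => (v, w)), √(degree A z.1) * √(degree A z.2) := by
        rw [sum_image hinj]
    _ ≤ _ := by
        refine sum_le_sum_of_subset_of_nonneg ?_ fun _ _ _ => by positivity
        intro z hz
        obtain ⟨w, hw, rfl⟩ := mem_image.1 hz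
        obtain ⟨h1, h2⟩ := mem_erase.1 hw
        simp [hv, h2, h1.symm]

/-- Exchanging sums weights each pair of vertices by its codegree. Cauchy-Schwarz then separates the
squared codegrees, which count pairs of edges with large intersection, from the products of degrees,
which sum to the square of the total degree. -/
lemma sum_sum_degree_erase_le [Fintype W] {r : ℕ} (A : ι → Finset W) (hA : ∀ e, #(A e) = r)
    {v : ι → W} (hv : ∀ e, v e ∈ A e) (hmax : ∀ e, ∀ w ∈ A e, degree A w ≤ degree A (v e)) :
    ∑ e, ∑ w ∈ (A e).erase (v e), (degree A w : ℝ) ≤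
      r ^ 2 * Fintype.card ι * √(∑ e, ∑ f, if 2 ≤ #(A e ∩ A f) then 1 else 0) := by
  set Q : ℝ := ∑ e, ∑ f, if 2 ≤ #(A e ∩ A f) then (1 : ℝ) else 0 with hQ
  have hQ0 : 0 ≤ Q := by positivity
  set cod : W × W → ℝ := fun z => ∑ e, if z ∈ (A e).offDiag then (1 : ℝ) else 0 with hcod
  -- A pair `(e, f)` is counted once for each ordered pair of distinct common vertices: at most `r ^
  -- 2` times, and never if fewer than two vertices are shared.
  have hcod2 : ∑ z, cod z ^ 2 ≤ r ^ 2 * Q := by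
    have h1 : ∀ z, cod z ^ 2 = ∑ e, ∑ f, if z ∈ (A e ∩ A f).offDiag then (1 : ℝ) else 0 := by
      intro z
      rw [hcod, sq, sum_mul_sum]
      refine sum_congr rfl fun e _ => sum_congr rfl fun f _ => ?_
      simp only [mem_offDiag, mem_inter]
      split_ifs <;> first | (exfalso; tauto) | norm_num
    simp_rw [h1]
    rw [sum_comm, hQ, mul_sum]
    refine sum_le_sum fun e _ => ?_
    rw [sum_comm, mul_sum]
    refine sum_le_sum fun f _ => ?_
    rw [sum_boole, filter_mem_eq_inter, univ_inter]
    have hle : #(A e ∩ A f) ≤ r := (card_le_card inter_subset_left).trans (hA e).le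
    split_ifs with h
    · rw [offDiag_card, mul_one]
      have : #(A e ∩ A f) * #(A e ∩ A f) - #(A e ∩ A f) ≤ r ^ 2 :=
        (Nat.sub_le _ _).trans (by rw [sq]; exact Nat.mul_le_mul hle hle)
      exact_mod_cast this
    · rw [offDiag_card]
      have h0 : #(A e ∩ A f) * #(A e ∩ A f) - #(A e ∩ A f) = 0 := by
        have : #(A e ∩ A f) = 0 ∨ #(A e ∩ A f) = 1 := by omega
        rcases this with h | h <;> simp [h]
      simp [h0]
  have hdeg : ∑ z : W × W, (√(degree A z.1) * √(degree A z.2)) ^ 2 =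
      (r * Fintype.card ι : ℝ) ^ 2 := by
    have h1 : ∑ w, (degree A w : ℝ) = r * Fintype.card ι := by
      have := sum_degree_eq_sum_card_inter A univ
      simp only [univ_inter, hA, sum_const, card_univ, smul_eq_mul] at this
      rw [mul_comm]
      exact_mod_cast this
    rw [← h1, sq, sum_mul_sum, Fintype.sum_prod_type]
    refine sum_congr rfl fun u _ => sum_congr rfl fun w _ => ?_
    rw [mul_pow, Real.sq_sqrt (by positivity), Real.sq_sqrt (by positivity)]
  calc ∑ e, ∑ w ∈ (A e).erase (v e), (degree A w : ℝ)
      ≤ ∑ e, ∑ z ∈ (A e).offDiag, √(degree A z.1) * √(degree A z.2) :=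
        sum_le_sum fun e _ => sum_degree_erase_le A (hv e) (hmax e)
    _ = ∑ z, cod z * (√(degree A z.1) * √(degree A z.2)) := by
        simp_rw [hcod, sum_mul]
        rw [sum_comm]
        refine sum_congr rfl fun e _ => ?_
        simp only [ite_mul, one_mul, zero_mul]
        rw [sum_ite_mem, univ_inter]
    _ ≤ √(∑ z, cod z ^ 2) * √(∑ z : W × W, (√(degree A z.1) * √(degree A z.2)) ^ 2) :=
        Real.sum_mul_le_sqrt_mul_sqrt _ _ _
    _ ≤ √(r ^ 2 * Q) * (r * Fintype.card ι) := by
        rw [hdeg, Real.sqrt_sq (by positivity)]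
        gcongr
    _ = _ := by
        rw [Real.sqrt_mul (by positivity), Real.sqrt_sq (by positivity)]
        ring

end Family

/-! ### Second moment and the approximate Poisson recursion -/

section Moments

variable {W C ι : Type*} [Fintype W] [DecidableEq W] [Fintype C]

/-- The probability that the set `t` is monochromatic after `s` is recolored with the color
of `v`. -/
noncomputable def condProb (C : Type*) [Fintype C] (s t : Finset W) (v : W) : ℝ :=
  𝔼 x : W → C, monoInd t (recolor (s.erase v) v x)

/-- The total probability of the pairs of distinct monochromatic sets of the family `A` that
intersect in at least two elements. -/
noncomputable def overlap (C : Type*) [Fintype C] [Fintype ι] [DecidableEq ι] (A : ι → Finset W) (v : ι → W) (p : ℝ) : ℝ :=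
  ∑ e, ∑ f, if f ≠ e ∧ 2 ≤ #(A e ∩ A f) then p * condProb C (A e) (A f) (v e) else 0

variable [DecidableEq C] [Nonempty C] {r : ℕ} {A : ι → Finset W} {v : ι → W} {p : ℝ}

lemma le_condProb (hA : ∀ e, #(A e) = r)
    (hp : p = ((Fintype.card C : ℝ) ^ (r - 1))⁻¹) (hv : ∀ e, v e ∈ A e) {e f : ι}
    (h : 2 ≤ #(A e ∩ A f)) :
    Fintype.card C * p ≤ condProb C (A e) (A f) (v e) := by
  have := expect_monoInd_recolor_of_two_le_card_inter (C := C) (hv e) h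
  rwa [hA, ← hp] at this

lemma condProb_eq (hr : 2 ≤ r) (hA : ∀ e, #(A e) = r)
    (hp : p = ((Fintype.card C : ℝ) ^ (r - 1))⁻¹) (hv : ∀ e, v e ∈ A e) {e f : ι}
    (h : #(A e ∩ A f) ≤ 1) : condProb C (A e) (A f) (v e) = p := by
  have := expect_monoInd_recolor_of_card_inter_le_one (C := C) (hv e)
    (card_pos.1 (by rw [hA f]; omega)) h
  rwa [hA, ← hp] at this

/-- The three terms on the right cover `f = e`, a large intersection, and a single common vertex
that changes color. -/
lemma expect_abs_sub_le [DecidableEq ι] (hr : 2 ≤ r) (hA : ∀ e, #(A e) = r)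
    (hp : p = ((Fintype.card C : ℝ) ^ (r - 1))⁻¹) (hv : ∀ e, v e ∈ A e) (e f : ι) :
    𝔼 x : W → C, |monoInd (A f) (recolor ((A e).erase (v e)) (v e) x) - monoInd (A f) x
        - if f = e then 1 else 0| ≤
      (if f = e then p else 0) +
      2 * (if f ≠ e ∧ 2 ≤ #(A e ∩ A f) then condProb C (A e) (A f) (v e) else 0) +
      2 * p * #((A e).erase (v e) ∩ A f) := by
  have hp0 : 0 < p := by rw [hp]; positivity
  have hf : 𝔼 x : W → C, monoInd (A f) x = p := by
    rw [expect_monoInd (card_pos.1 (by rw [hA]; omega)), hA, hp]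
  by_cases hef : f = e
  · subst hef
    -- The recolored set is itself monochromatic, so the 1 it gains cancels the subtracted 1 and
    -- only the old indicator remains.
    have h1 : ∀ x : W → C, |monoInd (A f) (recolor ((A f).erase (v f)) (v f) x) - monoInd (A f) x
        - if f = f then 1 else 0| = monoInd (A f) x := fun x => by
      rw [monoInd_recolor_eq_one (hv f), if_pos rfl, sub_sub_cancel_left, abs_neg,
        abs_of_nonneg (monoInd_nonneg _ _)]
    rw [expect_congr rfl fun x _ => h1 x, hf]
    simp only [if_true, ne_eq, not_true_eq_false, false_and, if_false]
    have : (0 : ℝ) ≤ 2 * p * #((A f).erase (v f) ∩ A f) := by positivity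
    linarith
  · have h1 : 𝔼 x : W → C, |monoInd (A f) (recolor ((A e).erase (v e)) (v e) x) - monoInd (A f) x
        - if f = e then 1 else 0| ≤ condProb C (A e) (A f) (v e) + p := by
      rw [condProb, ← hf, ← expect_add_distrib]
      refine expect_le_expect fun x _ => ?_
      rw [if_neg hef, sub_zero]
      have a := monoInd_nonneg (A f) x
      have b := monoInd_nonneg (A f) (recolor ((A e).erase (v e)) (v e) x)
      rw [abs_le]
      constructor <;> linarith
    have h0 : (0 : ℝ) ≤ 2 * p * #((A e).erase (v e) ∩ A f) := by positivity
    by_cases h2 : 2 ≤ #(A e ∩ A f)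
    · have h3 : p ≤ condProb C (A e) (A f) (v e) := by
        refine le_trans ?_ (le_condProb (C := C) hA hp hv h2)
        have : (1 : ℝ) ≤ Fintype.card C := by exact_mod_cast Fintype.card_pos
        nlinarith
      simp only [hef, h2, if_false, ne_eq, not_false_eq_true, and_self, if_true] at h1 ⊢
      linarith
    · rw [condProb_eq hr hA hp hv (by omega)] at h1 ⊢
      by_cases hd : Disjoint ((A e).erase (v e)) (A f)
      · simp_rw [monoInd_recolor_of_disjoint hd, if_neg hef]
        simpa [h2] using h0
      · have h3 : (1 : ℝ) ≤ #((A e).erase (v e) ∩ A f) := by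
          have : 1 ≤ #((A e).erase (v e) ∩ A f) :=
            card_pos.2 (nonempty_iff_ne_empty.2 fun h => hd (disjoint_iff_inter_eq_empty.2 h))
          exact_mod_cast this
        simp only [hef, h2, if_false, and_false, mul_zero, zero_add] at h1 ⊢
        nlinarith

variable [Fintype ι]

lemma expect_monoCount (hr : 1 ≤ r) (hA : ∀ e, #(A e) = r)
    (hp : p = ((Fintype.card C : ℝ) ^ (r - 1))⁻¹) :
    𝔼 x : W → C, (monoCount A x : ℝ) = Fintype.card ι * p := by
  simp_rw [monoCount_eq_sum]
  rw [expect_sum_comm]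
  have : ∀ e, 𝔼 x : W → C, monoInd (A e) x = p := fun e => by
    rw [expect_monoInd (card_pos.1 (by rw [hA]; omega)), hA, hp]
  simp [this]

lemma expect_monoCount_mul (hA : ∀ e, #(A e) = r)
    (hp : p = ((Fintype.card C : ℝ) ^ (r - 1))⁻¹) (hv : ∀ e, v e ∈ A e) (g : ℕ → ℝ) :
    𝔼 x : W → C, (monoCount A x : ℝ) * g (monoCount A x) =
      p * ∑ e, 𝔼 x : W → C, g (monoCount A (recolor ((A e).erase (v e)) (v e) x)) := by
  have : ∀ x : W → C, (monoCount A x : ℝ) * g (monoCount A x) =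
      ∑ e, monoInd (A e) x * g (monoCount A x) := fun x => by
    rw [monoCount_eq_sum, sum_mul]
  simp_rw [this]
  rw [expect_sum_comm, mul_sum]
  refine sum_congr rfl fun e _ => ?_
  rw [expect_monoInd_mul_eq (hv e) (fun x => g (monoCount A x)), hA, hp]

lemma expect_monoCount_sq (hA : ∀ e, #(A e) = r)
    (hp : p = ((Fintype.card C : ℝ) ^ (r - 1))⁻¹) (hv : ∀ e, v e ∈ A e) :
    𝔼 x : W → C, (monoCount A x : ℝ) ^ 2 = ∑ e, ∑ f, p * condProb C (A e) (A f) (v e) := by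
  simp_rw [sq]
  rw [expect_monoCount_mul hA hp hv (fun n => (n : ℝ)), mul_sum]
  refine sum_congr rfl fun e _ => ?_
  simp_rw [monoCount_eq_sum, condProb]
  rw [expect_sum_comm, mul_sum]

variable [DecidableEq ι]

/-- The variance is the sum of `p * condProb - p ^ 2` over all pairs: the diagonal gives the mean up
to `p ^ 2` terms, and intersections of size at most one give 0. With two or more colors, `condProb`
is at least `2 * p` for a larger intersection, so subtracting `p ^ 2` costs at most half of the
term. -/
lemma overlap_le (hr : 2 ≤ r) (hA : ∀ e, #(A e) = r)
    (hp : p = ((Fintype.card C : ℝ) ^ (r - 1))⁻¹) (hv : ∀ e, v e ∈ A e)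
    (hC : 2 ≤ Fintype.card C) :
    overlap C A v p ≤ 2 * (𝔼 x : W → C, (monoCount A x : ℝ) ^ 2
      - (𝔼 x : W → C, (monoCount A x : ℝ)) ^ 2 - Fintype.card ι * p
      + p * (Fintype.card ι * p)) := by
  have hp0 : 0 < p := by rw [hp]; positivity
  have hC' : (2 : ℝ) ≤ Fintype.card C := by exact_mod_cast hC
  have key : ∀ e f : ι, (if f = e then p - p ^ 2 else 0) +
      (if f ≠ e ∧ 2 ≤ #(A e ∩ A f) then p * condProb C (A e) (A f) (v e) else 0) / 2 ≤
      p * condProb C (A e) (A f) (v e) - p ^ 2 := by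
    intro e f
    by_cases hef : f = e
    · subst hef
      have : condProb C (A f) (A f) (v f) = 1 := by
        simp [condProb, monoInd_recolor_eq_one (hv f)]
      simp [this]
    · by_cases h2 : 2 ≤ #(A e ∩ A f)
      · have h3 := le_condProb (C := C) hA hp hv h2
        have h4 : 2 * p ≤ condProb C (A e) (A f) (v e) := le_trans (by gcongr) h3
        simp only [hef, h2, if_false, ne_eq, not_false_eq_true, and_self, if_true]
        nlinarith
      · rw [condProb_eq hr hA hp hv (by omega)]
        simp [hef, h2, sq]
  have hsum := sum_le_sum fun e (_ : e ∈ univ) => sum_le_sum fun f (_ : f ∈ univ) => key e f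
  simp only [sum_add_distrib, sum_sub_distrib, sum_ite_eq', mem_univ, if_true, ← sum_div,
    ← expect_monoCount_sq hA hp hv, sum_const, card_univ, nsmul_eq_mul] at hsum
  rw [expect_monoCount (by omega) hA hp]
  unfold overlap
  nlinarith

lemma sq_mul_sum_le (hA : ∀ e, #(A e) = r)
    (hp : p = ((Fintype.card C : ℝ) ^ (r - 1))⁻¹) (hv : ∀ e, v e ∈ A e) :
    p ^ 2 * (∑ e, ∑ f, if 2 ≤ #(A e ∩ A f) then 1 else 0) ≤
      p * (Fintype.card ι * p) + overlap C A v p := by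
  have hp0 : 0 < p := by rw [hp]; positivity
  have key : ∀ e f : ι, p ^ 2 * (if 2 ≤ #(A e ∩ A f) then 1 else 0) ≤
      (if f = e then p ^ 2 else 0) +
      if f ≠ e ∧ 2 ≤ #(A e ∩ A f) then p * condProb C (A e) (A f) (v e) else 0 := by
    intro e f
    by_cases hef : f = e
    · subst hef
      simp only [if_true, ne_eq, not_true_eq_false, false_and, if_false]
      split_ifs <;> nlinarith
    · by_cases h2 : 2 ≤ #(A e ∩ A f)
      · have h3 : p ≤ condProb C (A e) (A f) (v e) := by
          refine le_trans ?_ (le_condProb (C := C) hA hp hv h2)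
          have : (1 : ℝ) ≤ Fintype.card C := by exact_mod_cast Fintype.card_pos
          nlinarith
        simp only [hef, h2, if_false, ne_eq, not_false_eq_true, and_self, if_true]
        nlinarith
      · simp [hef, h2]
  have hsum := sum_le_sum fun e (_ : e ∈ univ) => sum_le_sum fun f (_ : f ∈ univ) => key e f
  simp only [sum_add_distrib, sum_ite_eq', mem_univ, if_true, sum_const, card_univ, nsmul_eq_mul,
    ← mul_sum] at hsum
  unfold overlap
  linarith

/-- An approximate form of the Stein equation of the Poisson distribution for the number of
monochromatic sets. -/
lemma abs_succ_mul_expect_sub_le (hr : 2 ≤ r) (hA : ∀ e, #(A e) = r)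
    (hp : p = ((Fintype.card C : ℝ) ^ (r - 1))⁻¹) (hv : ∀ e, v e ∈ A e)
    (hmax : ∀ e, ∀ w ∈ A e, degree A w ≤ degree A (v e)) (k : ℕ) :
    |(k + 1) * 𝔼 x : W → C, (if monoCount A x = k + 1 then (1 : ℝ) else 0)
      - Fintype.card ι * p * 𝔼 x : W → C, (if monoCount A x = k then (1 : ℝ) else 0)| ≤
      p * (Fintype.card ι * p) + 2 * overlap C A v p + 2 * r ^ 2 * (Fintype.card ι * p) *
        √(p * (Fintype.card ι * p) + overlap C A v p) := by
  have hp0 : 0 < p := by rw [hp]; positivity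
  have h1 : (k + 1) * 𝔼 x : W → C, (if monoCount A x = k + 1 then (1 : ℝ) else 0) =
      p * ∑ e, 𝔼 x : W → C, if monoCount A (recolor ((A e).erase (v e)) (v e) x) = k + 1
        then (1 : ℝ) else 0 := by
    rw [← expect_monoCount_mul hA hp hv (fun n => if n = k + 1 then (1 : ℝ) else 0), mul_expect]
    refine expect_congr rfl fun x _ => ?_
    split_ifs with h
    · simp [h]
    · simp
  have h2 : Fintype.card ι * p * 𝔼 x : W → C, (if monoCount A x = k then (1 : ℝ) else 0) =
      p * ∑ _e : ι, 𝔼 x : W → C, if monoCount A x = k then (1 : ℝ) else 0 := by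
    rw [sum_const, card_univ, nsmul_eq_mul]
    ring
  have h3 : ∀ e, |(𝔼 x : W → C, if monoCount A (recolor ((A e).erase (v e)) (v e) x) = k + 1
        then (1 : ℝ) else 0) - 𝔼 x : W → C, if monoCount A x = k then (1 : ℝ) else 0| ≤
      p + 2 * (∑ f, if f ≠ e ∧ 2 ≤ #(A e ∩ A f) then condProb C (A e) (A f) (v e) else 0) +
      2 * p * ∑ w ∈ (A e).erase (v e), (degree A w : ℝ) := by
    intro e
    have hdeg : ∑ w ∈ (A e).erase (v e), (degree A w : ℝ) =
        ∑ f, (#((A e).erase (v e) ∩ A f) : ℝ) := by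
      exact_mod_cast sum_degree_eq_sum_card_inter A ((A e).erase (v e))
    have hsum := sum_le_sum fun f (_ : f ∈ univ) =>
      expect_abs_sub_le (C := C) hr hA hp hv e f
    simp only [sum_add_distrib, sum_ite_eq', mem_univ, if_true, ← mul_sum, ← hdeg] at hsum
    refine le_trans ?_ hsum
    rw [← expect_sub_distrib, ← expect_sum_comm]
    refine (abs_expect_le _ _).trans (expect_le_expect fun x _ => ?_)
    -- The 1 in N^e - N - 1 is charged to the summand `f = e`.
    refine (abs_ite_sub_ite_le _ _ _).trans ?_
    refine le_trans (le_of_eq ?_) (abs_sum_le_sum_abs _ _)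
    congr 1
    rw [sum_sub_distrib, sum_sub_distrib, monoCount_eq_sum, monoCount_eq_sum]
    simp
  have h4 : p ^ 2 * ∑ e, ∑ w ∈ (A e).erase (v e), (degree A w : ℝ) ≤
      r ^ 2 * (Fintype.card ι * p) * √(p * (Fintype.card ι * p) + overlap C A v p) := by
    calc p ^ 2 * ∑ e, ∑ w ∈ (A e).erase (v e), (degree A w : ℝ)
        ≤ p ^ 2 * (r ^ 2 * Fintype.card ι *
          √(∑ e, ∑ f, if 2 ≤ #(A e ∩ A f) then 1 else 0)) := by
          gcongr
          exact sum_sum_degree_erase_le A hA hv hmax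
      _ = r ^ 2 * (Fintype.card ι * p) *
          √(p ^ 2 * ∑ e, ∑ f, if 2 ≤ #(A e ∩ A f) then 1 else 0) := by
          rw [Real.sqrt_mul (by positivity), Real.sqrt_sq hp0.le]
          ring
      _ ≤ _ := by
          gcongr
          exact sq_mul_sum_le hA hp hv
  have h5 : overlap C A v p = p * ∑ e, ∑ f, if f ≠ e ∧ 2 ≤ #(A e ∩ A f) then
      condProb C (A e) (A f) (v e) else 0 := by
    simp only [overlap, mul_sum, mul_ite, mul_zero]
  have hsum := sum_le_sum fun e (_ : e ∈ univ) => h3 e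
  simp only [sum_add_distrib, sum_const, card_univ, nsmul_eq_mul, ← mul_sum] at hsum
  rw [h1, h2, ← mul_sub, ← sum_sub_distrib, abs_mul, abs_of_pos hp0]
  have h6 := mul_le_mul_of_nonneg_left ((abs_sum_le_sum_abs _ _).trans hsum) hp0.le
  refine h6.trans ?_
  rw [h5] at h4 ⊢
  linarith

end Moments

end RandomColoring

/-! ### Poisson convergence from an asymptotic recursion -/

namespace RandomColoring

open MeasureTheory ProbabilityTheory Filter Topology NNReal

section PoissonLimit

lemma abs_sub_sum_ite_le {g : ℕ → ℝ} {G : ℝ} (hg : ∀ k, |g k| ≤ G) {K : ℕ} (hK : 0 < K)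
    (m : ℕ) : |g m - ∑ k ∈ Finset.range K, g k * (if m = k then 1 else 0)| ≤ G / K * m := by
  have hG : 0 ≤ G := (abs_nonneg _).trans (hg 0)
  have hK' : (0 : ℝ) < K := by exact_mod_cast hK
  simp only [mul_ite, mul_one, mul_zero, Finset.sum_ite_eq, Finset.mem_range]
  split_ifs with h
  · rw [sub_self, abs_zero]; positivity
  · have : (K : ℝ) ≤ m := by exact_mod_cast not_lt.1 h
    rw [sub_zero]
    calc |g m| ≤ G := hg m
      _ = G / K * K := by field_simp
      _ ≤ _ := by gcongr

/-- Markov's inequality in disguise: truncating at `K` costs at most `G` on the event `K ≤ N`.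
Bounded means thus give tightness. -/
lemma abs_integral_sub_sum_le {Ω : Type*} [MeasurableSpace Ω] (P : Measure Ω)
    [IsProbabilityMeasure P] {N : Ω → ℕ} (hN : Measurable N)
    (hint : Integrable (fun ω => (N ω : ℝ)) P) {g : ℕ → ℝ} {G : ℝ} (hg : ∀ k, |g k| ≤ G)
    {K : ℕ} (hK : 0 < K) :
    |∫ ω, g (N ω) ∂P - ∑ k ∈ Finset.range K, g k * P.real {ω | N ω = k}| ≤
      G / K * ∫ ω, (N ω : ℝ) ∂P := by
  have hms : ∀ k, MeasurableSet {ω | N ω = k} := fun k => hN (measurableSet_singleton k)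
  have hind : ∀ k, Integrable (fun ω => if N ω = k then (1 : ℝ) else 0) P := fun k =>
    ((integrable_const (1 : ℝ)).indicator (hms k)).congr
      (ae_of_all _ fun ω => by simp [Set.indicator_apply])
  have hindint : ∀ k, ∫ ω, (if N ω = k then (1 : ℝ) else 0) ∂P = P.real {ω | N ω = k} := fun k => by
    simpa [Set.indicator_apply] using integral_indicator_one (μ := P) (hms k)
  have hgi : Integrable (fun ω => g (N ω)) P :=
    Integrable.of_bound ((measurable_from_nat (f := g)).comp hN).aestronglyMeasurable G
      (ae_of_all _ fun ω => hg _)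
  simp_rw [← hindint, ← integral_const_mul]
  rw [← integral_finsetSum _ fun k _ => (hind k).const_mul (g k),
    ← integral_sub hgi (integrable_finsetSum _ fun k _ => (hind k).const_mul (g k))]
  rw [← Real.norm_eq_abs]
  refine norm_integral_le_of_norm_le (hint.const_mul _) (ae_of_all _ fun ω => ?_)
  exact abs_sub_sum_ite_le hg hK (N ω)

variable {Ω : ℕ → Type*} [∀ n, MeasurableSpace (Ω n)] {P : (n : ℕ) → Measure (Ω n)}
  {N : (n : ℕ) → Ω n → ℕ} {lam : ℝ≥0}

lemma tendsto_real_sub_of_recursion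
    (hrec : ∀ k : ℕ, Tendsto (fun n => (k + 1) * (P n).real {ω | N n ω = k + 1}
      - lam * (P n).real {ω | N n ω = k}) atTop (𝓝 0)) (k : ℕ) :
    Tendsto (fun n => (P n).real {ω | N n ω = k}
      - (P n).real {ω | N n ω = 0} * (lam ^ k / k.factorial)) atTop (𝓝 0) := by
  induction k with
  | zero => simp
  | succ k ih =>
    have h := ((hrec k).add (ih.const_mul (lam : ℝ))).const_mul ((k + 1 : ℝ)⁻¹)
    simp only [mul_zero, add_zero] at h
    refine h.congr fun n => ?_
    rw [Nat.factorial_succ]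
    push_cast
    field_simp
    ring

variable [∀ n, IsProbabilityMeasure (P n)]

/-- The recursion fixes the law only up to the unknown factor P(N = 0), which need not be known to
converge yet. -/
lemma tendsto_integral_sub_of_recursion (hN : ∀ n, Measurable (N n))
    (hint : ∀ n, Integrable (fun ω => (N n ω : ℝ)) (P n)) {M : ℝ}
    (hM : ∀ᶠ n in atTop, ∫ ω, (N n ω : ℝ) ∂(P n) ≤ M)
    (hrec : ∀ k : ℕ, Tendsto (fun n => (k + 1) * (P n).real {ω | N n ω = k + 1}
      - lam * (P n).real {ω | N n ω = k}) atTop (𝓝 0))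
    {g : ℕ → ℝ} {G : ℝ} (hg : ∀ k, |g k| ≤ G) :
    Tendsto (fun n => ∫ ω, g (N n ω) ∂(P n)
      - (P n).real {ω | N n ω = 0} * ∑' k : ℕ, g k * (lam ^ k / k.factorial)) atTop (𝓝 0) := by
  have hG : 0 ≤ G := (abs_nonneg _).trans (hg 0)
  have hsum : Summable fun k : ℕ => g k * ((lam : ℝ) ^ k / k.factorial) := by
    refine Summable.of_norm_bounded ((Real.summable_pow_div_factorial (lam : ℝ)).mul_left G)
      fun k => ?_
    rw [norm_mul, Real.norm_eq_abs, Real.norm_of_nonneg (by positivity)]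
    exact mul_le_mul_of_nonneg_right (hg k) (by positivity)
  set s := ∑' k : ℕ, g k * ((lam : ℝ) ^ k / k.factorial) with hs
  rw [Metric.tendsto_atTop']
  intro ε hε
  have htail := hsum.hasSum.tendsto_sum_nat
  have hK1 : ∀ᶠ K : ℕ in atTop, |∑ k ∈ Finset.range K, g k * ((lam : ℝ) ^ k / k.factorial) - s| <
      ε / 3 := (Metric.tendsto_nhds.1 htail) (ε / 3) (by positivity)
  have hK2 : ∀ᶠ K : ℕ in atTop, G * M / K < ε / 3 :=
    (tendsto_const_div_atTop_nhds_zero_nat (G * M)).eventually (gt_mem_nhds (by positivity))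
  -- The error splits into the tail of the series, the truncation of the expectation and finitely
  -- many point probabilities, at ε/3 each.
  obtain ⟨K, hK1, hK2, hK0⟩ := (hK1.and (hK2.and (eventually_gt_atTop 0))).exists
  have hfin : Tendsto (fun n => ∑ k ∈ Finset.range K, g k * ((P n).real {ω | N n ω = k}
      - (P n).real {ω | N n ω = 0} * (lam ^ k / k.factorial))) atTop (𝓝 0) := by
    have := tendsto_finsetSum (Finset.range K) fun k _ =>
      (tendsto_real_sub_of_recursion hrec k).const_mul (g k)
    simpa using this
  have hfin' := (Metric.tendsto_nhds.1 hfin) (ε / 3) (by positivity)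
  obtain ⟨n₀, hn₀⟩ := eventually_atTop.1 (hfin'.and hM)
  refine ⟨n₀, fun n hn => ?_⟩
  obtain ⟨h1, h2⟩ := hn₀ n hn.le
  rw [Real.dist_eq, sub_zero] at h1 ⊢
  have h3 := abs_integral_sub_sum_le (P n) (hN n) (hint n) hg hK0
  have h4 : G / K * ∫ ω, (N n ω : ℝ) ∂(P n) ≤ G * M / K := by
    rw [div_mul_eq_mul_div]
    gcongr
  set a := (P n).real {ω | N n ω = 0} with ha
  have ha0 : 0 ≤ a := measureReal_nonneg
  have ha1 : a ≤ 1 := measureReal_le_one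
  have h5 : |a * (∑ k ∈ Finset.range K, g k * ((lam : ℝ) ^ k / k.factorial) - s)| < ε / 3 := by
    rw [abs_mul, abs_of_nonneg ha0]
    exact (mul_le_of_le_one_left (abs_nonneg _) ha1).trans_lt hK1
  have h6 : ∑ k ∈ Finset.range K, g k * ((P n).real {ω | N n ω = k}
      - a * (lam ^ k / k.factorial)) =
      ∑ k ∈ Finset.range K, g k * (P n).real {ω | N n ω = k}
      - a * ∑ k ∈ Finset.range K, g k * ((lam : ℝ) ^ k / k.factorial) := by
    rw [Finset.mul_sum, ← Finset.sum_sub_distrib]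
    exact Finset.sum_congr rfl fun k _ => by ring
  rw [h6] at h1
  have h7 := h3.trans_lt (h4.trans_lt hK2)
  rw [abs_lt] at *
  rw [mul_sub] at h5
  constructor <;> linarith [h1.1, h1.2, h5.1, h5.2, h7.1, h7.2]

/-- Integer valued random variables with bounded means whose laws asymptotically satisfy the
recursion `(k + 1) p (k + 1) = lam p k` of the Poisson distribution converge to it. -/
theorem tendsto_integral_poissonMeasure_of_recursion (hN : ∀ n, Measurable (N n))
    (hint : ∀ n, Integrable (fun ω => (N n ω : ℝ)) (P n)) {M : ℝ}
    (hM : ∀ᶠ n in atTop, ∫ ω, (N n ω : ℝ) ∂(P n) ≤ M)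
    (hrec : ∀ k : ℕ, Tendsto (fun n => (k + 1) * (P n).real {ω | N n ω = k + 1}
      - lam * (P n).real {ω | N n ω = k}) atTop (𝓝 0))
    {g : ℕ → ℝ} {G : ℝ} (hg : ∀ k, |g k| ≤ G) :
    Tendsto (fun n => ∫ ω, g (N n ω) ∂(P n)) atTop (𝓝 (∫ k, g k ∂(poissonMeasure lam))) := by
  have hexp : ∑' k : ℕ, (lam : ℝ) ^ k / k.factorial = Real.exp lam := by
    rw [Real.exp_eq_exp_ℝ, NormedSpace.exp_eq_tsum_div]
  have h0 : Tendsto (fun n => (P n).real {ω | N n ω = 0}) atTop (𝓝 (Real.exp (-lam))) := by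
    -- Testing against the constant 1 is normalization: it identifies the limit of P(N = 0).
    have h := tendsto_integral_sub_of_recursion hN hint hM hrec (g := fun _ => 1) (G := 1)
      (by simp)
    simp only [integral_const, probReal_univ, one_smul, one_mul, hexp] at h
    have h' := (h.const_sub 1).mul_const (Real.exp (-lam))
    simp only [sub_zero, one_mul, sub_sub_cancel] at h'
    refine h'.congr fun n => ?_
    rw [mul_assoc, ← Real.exp_add, add_neg_cancel, Real.exp_zero, mul_one]
  have h := (tendsto_integral_sub_of_recursion hN hint hM hrec hg).add
    (h0.mul_const (∑' k : ℕ, g k * ((lam : ℝ) ^ k / k.factorial)))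
  simp only [sub_add_cancel, zero_add] at h
  convert h using 2
  rw [integral_poissonMeasure, ← _root_.tsum_mul_left]
  refine tsum_congr fun k => ?_
  rw [smul_eq_mul]
  ring

theorem tendstoInDistribution_poissonMeasure_of_recursion (hN : ∀ n, Measurable (N n))
    (hint : ∀ n, Integrable (fun ω => (N n ω : ℝ)) (P n)) {M : ℝ}
    (hM : ∀ᶠ n in atTop, ∫ ω, (N n ω : ℝ) ∂(P n) ≤ M)
    (hrec : ∀ k : ℕ, Tendsto (fun n => (k + 1) * (P n).real {ω | N n ω = k + 1}
      - lam * (P n).real {ω | N n ω = k}) atTop (𝓝 0)) :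
    TendstoInDistribution (fun n ω => (N n ω : ℝ)) atTop (fun k : ℕ => (k : ℝ)) P
      (poissonMeasure lam) where
  forall_aemeasurable n := (measurable_from_nat.comp (hN n)).aemeasurable
  aemeasurable_limit := measurable_from_nat.aemeasurable
  tendsto := by
    refine ProbabilityMeasure.tendsto_iff_forall_integral_tendsto.2 fun f => ?_
    have h1 : ∀ n, ∫ x, f x ∂((P n).map fun ω => (N n ω : ℝ)) = ∫ ω, f (N n ω) ∂(P n) := fun n =>
      integral_map (measurable_from_nat.comp (hN n)).aemeasurable
        f.continuous.aestronglyMeasurable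
    have h2 : ∫ x, f x ∂((poissonMeasure lam).map fun k : ℕ => (k : ℝ)) =
        ∫ k : ℕ, f k ∂(poissonMeasure lam) :=
      integral_map measurable_from_nat.aemeasurable f.continuous.aestronglyMeasurable
    change Tendsto (fun n => ∫ x, f x ∂((P n).map fun ω => (N n ω : ℝ))) atTop
      (𝓝 (∫ x, f x ∂((poissonMeasure lam).map fun k : ℕ => (k : ℝ))))
    simp_rw [h1, h2]
    exact tendsto_integral_poissonMeasure_of_recursion hN hint hM hrec (g := fun k => f k)
      (G := ‖f‖) fun k => f.norm_coe_le_norm _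

end PoissonLimit

end RandomColoring

/-! ### From random colorings of hypergraphs to finite averages -/

namespace RandomColoring

open MeasureTheory ProbabilityTheory Filter Topology NNReal
open scoped BigOperators

/-- The monochromatic hyperedges of a finite uniform hypergraph are counted by a finite family of
finite sets. -/
lemma exists_family {V : Type*} (H : Hypergraph V) (hfin : H.edgeSet.Finite) {r : ℕ}
    (hunif : H.IsUniformOfRank r) (C : Type*) :
    ∃ (S : Set H.vertexSet) (_ : Fintype S) (_ : Fintype H.edgeSet)
      (A : H.edgeSet → Finset S), (∀ e, (A e).card = r) ∧
      ∀ x : H.vertexSet → C, H.monochromaticCount x = monoCount A (fun w => x w) := by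
  classical
  have hefin : ∀ e ∈ H.edgeSet, e.Finite := fun e he =>
    Set.finite_of_encard_eq_coe (hunif e he)
  -- The vertex set may be infinite, but only the finitely many vertices lying in hyperedges affect
  -- the count.
  set S : Set H.vertexSet := {v | ∃ e ∈ H.edgeSet, (v : V) ∈ e} with hS
  have hSfin : S.Finite := by
    refine Set.Finite.of_finite_image (f := Subtype.val)
      ((hfin.biUnion hefin).subset ?_) Subtype.val_injective.injOn
    rintro _ ⟨v, ⟨e, he, hv⟩, rfl⟩
    exact Set.mem_biUnion he hv
  let iS : Fintype S := hSfin.fintype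
  let iE : Fintype H.edgeSet := hfin.fintype
  let A : H.edgeSet → Finset S := fun e => {w | (w.1 : V) ∈ e.1}
  refine ⟨S, iS, iE, A, fun e => ?_, fun x => ?_⟩
  · have himg : (fun w : S => (w.1 : V)) '' (A e : Set S) = e.1 := by
      ext v
      constructor
      · rintro ⟨w, hw, rfl⟩
        simpa [A] using hw
      · intro hv
        exact ⟨⟨⟨v, H.subset_vertexSet_of_mem_edgeSet' e.2 hv⟩, e.1, e.2, hv⟩, by simpa [A] using hv,
          rfl⟩
    have hinj : Function.Injective (fun w : S => (w.1 : V)) :=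
      Subtype.val_injective.comp Subtype.val_injective
    have h := hunif e.1 e.2
    rw [← himg, hinj.encard_image, Set.encard_coe_eq_coe_finsetCard] at h
    exact_mod_cast h
  · have hmono : ∀ e : H.edgeSet, H.IsMonochromatic x e.1 ↔
        ∀ v ∈ A e, ∀ w ∈ A e, x v.1 = x w.1 := by
      intro e
      constructor
      · intro h v hv w hw
        exact h v w (by simpa [A] using hv) (by simpa [A] using hw)
      · intro h v w hv hw
        exact h ⟨v, e.1, e.2, hv⟩ (by simpa [A] using hv) ⟨w, e.1, e.2, hw⟩ (by simpa [A] using hw)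
    have hset : {e | e ∈ H.edgeSet ∧ H.IsMonochromatic x e} =
        Subtype.val '' (({e : H.edgeSet | ∀ v ∈ A e, ∀ w ∈ A e, x v.1 = x w.1} :
          Finset H.edgeSet) : Set H.edgeSet) := by
      ext e
      constructor
      · rintro ⟨he, h⟩
        exact ⟨⟨e, he⟩, by simpa using (hmono ⟨e, he⟩).1 h, rfl⟩
      · rintro ⟨e, h, rfl⟩
        exact ⟨e.2, (hmono e).2 (by simpa using h)⟩
    rw [Hypergraph.monochromaticCount, hset, Set.ncard_image_of_injective _ Subtype.val_injective,
      Set.ncard_coe_finset, monoCount]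
    congr!

lemma integral_eq_expect {Ω W : Type*} [MeasurableSpace Ω] {P : Measure Ω}
    [IsProbabilityMeasure P] [Fintype W] [DecidableEq W] {c : ℕ} {Y : W → Ω → Fin c}
    (hY : ∀ w, Measurable (Y w)) (hunif : ∀ w a, P.real {ω | Y w ω = a} = 1 / (c : ℝ))
    (hind : iIndepFun Y P) (g : (W → Fin c) → ℝ) :
    ∫ ω, g (fun w => Y w ω) ∂P = 𝔼 x, g x := by
  have hm : Measurable fun ω w => Y w ω := measurable_pi_lambda _ hY
  have hpt : ∀ x : W → Fin c, (P.map fun ω w => Y w ω).real {x} =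
      ((c : ℝ) ^ Fintype.card W)⁻¹ := by
    intro x
    have hset : (fun ω w => Y w ω) ⁻¹' {x} = ⋂ w, Y w ⁻¹' {x w} := by
      ext ω
      simp [funext_iff]
    rw [map_measureReal_apply hm (measurableSet_singleton x), hset, measureReal_def,
      hind.meas_iInter fun w => ⟨{x w}, measurableSet_singleton _, rfl⟩, ENNReal.toReal_prod]
    have : ∀ w, (P (Y w ⁻¹' {x w})).toReal = 1 / (c : ℝ) := fun w => hunif w (x w)
    simp [this]
  have : IsProbabilityMeasure (P.map fun ω w => Y w ω) :=
    Measure.isProbabilityMeasure_map hm.aemeasurable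
  rw [← integral_map (φ := fun ω w => Y w ω) (f := g) hm.aemeasurable
    (Measurable.of_discrete).aestronglyMeasurable, integral_fintype (Integrable.of_finite),
    Fintype.expect_eq_sum_div_card]
  simp_rw [hpt]
  rw [← Finset.smul_sum, smul_eq_mul, Fintype.card_fun, Fintype.card_fin, div_eq_inv_mul]
  push_cast
  rfl

/-- The bound on the defect in the Poisson recursion in terms of the mean `m` and the variance `s`
of the number of monochromatic hyperedges, and the probability `p` of a hyperedge to be
monochromatic. -/
noncomputable def defect (r : ℕ) (p m s : ℝ) : ℝ :=
  p * m + 2 * (2 * (s - m + p * m)) + 2 * r ^ 2 * m * √(p * m + 2 * (s - m + p * m))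

section Hypergraph

variable {V Ω : Type*} [MeasurableSpace Ω] {H : Hypergraph V} {r c : ℕ} {P : Measure Ω}
  {X : H.vertexSet → Ω → Fin c}

lemma measurable_monochromaticCount (hfin : H.edgeSet.Finite) (hunif : H.IsUniformOfRank r)
    (hX : H.IsUniformRandomColoring c P X) :
    Measurable fun ω => H.monochromaticCount fun v => X v ω := by
  obtain ⟨S, _, _, A, -, hA⟩ := exists_family H hfin hunif (Fin c)
  simp_rw [hA]
  exact (Measurable.of_discrete (f := fun x : S → Fin c => monoCount A x)).comp
    (measurable_pi_lambda _ fun w => hX.measurable w)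

variable [IsProbabilityMeasure P]

lemma memLp_monochromaticCount (hfin : H.edgeSet.Finite) (hunif : H.IsUniformOfRank r)
    (hX : H.IsUniformRandomColoring c P X) :
    MemLp (fun ω => (H.monochromaticCount fun v => X v ω : ℝ)) 2 P := by
  refine MemLp.of_bound (measurable_from_nat.comp
    (measurable_monochromaticCount hfin hunif hX)).aestronglyMeasurable (H.edgeSet.ncard : ℝ)
    (ae_of_all _ fun ω => ?_)
  rw [Real.norm_of_nonneg (by positivity)]
  have h : H.monochromaticCount (fun v => X v ω) ≤ H.edgeSet.ncard :=
    Set.ncard_le_ncard (fun e he => he.1) hfin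
  exact_mod_cast h

lemma abs_succ_mul_real_sub_le (hr : 2 ≤ r) (hfin : H.edgeSet.Finite)
    (hunif : H.IsUniformOfRank r) (hX : H.IsUniformRandomColoring c P X) (hc : 2 ≤ c) (k : ℕ) :
    |(k + 1) * P.real {ω | H.monochromaticCount (fun v => X v ω) = k + 1}
      - (∫ ω, (H.monochromaticCount (fun v => X v ω) : ℝ) ∂P)
        * P.real {ω | H.monochromaticCount (fun v => X v ω) = k}| ≤
      defect r ((c : ℝ) ^ (r - 1))⁻¹ (∫ ω, (H.monochromaticCount (fun v => X v ω) : ℝ) ∂P)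
        (variance (fun ω => (H.monochromaticCount (fun v => X v ω) : ℝ)) P) := by
  classical
  have hmeas := measurable_monochromaticCount hfin hunif hX
  have hLp := memLp_monochromaticCount hfin hunif hX
  obtain ⟨S, _, _, A, hcard, hA⟩ := exists_family H hfin hunif (Fin c)
  have : NeZero c := ⟨by omega⟩
  have hE : ∀ g : ℕ → ℝ, ∫ ω, g (H.monochromaticCount fun v => X v ω) ∂P =
      𝔼 x : S → Fin c, g (monoCount A x) := by
    intro g
    simp_rw [hA]
    exact integral_eq_expect (Y := fun w : S => X w) (fun w => hX.measurable w)
      (fun w => hX.uniform w) (hX.indep.precomp Subtype.val_injective)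
      (fun x => g (monoCount A x))
  have hprob : ∀ k, P.real {ω | H.monochromaticCount (fun v => X v ω) = k} =
      𝔼 x : S → Fin c, if monoCount A x = k then (1 : ℝ) else 0 := by
    intro k
    rw [← hE fun m => if m = k then (1 : ℝ) else 0]
    have hms : MeasurableSet {ω | H.monochromaticCount (fun v => X v ω) = k} :=
      hmeas (measurableSet_singleton k)
    simpa [Set.indicator_apply] using (integral_indicator_one (μ := P) hms).symm
  choose v hv hmax using fun e => exists_mem_forall_degree_le A (s := A e)
    (Finset.card_pos.1 (by rw [hcard]; omega))
  set p : ℝ := ((c : ℝ) ^ (r - 1))⁻¹ with hp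
  have hp0 : 0 ≤ p := by positivity
  have hp' : p = ((Fintype.card (Fin c) : ℝ) ^ (r - 1))⁻¹ := by rw [Fintype.card_fin]
  have hmean : ∫ ω, (H.monochromaticCount (fun v => X v ω) : ℝ) ∂P =
      Fintype.card H.edgeSet * p := by
    rw [hE fun m => (m : ℝ), expect_monoCount (by omega) hcard hp']
  have hoverlap := overlap_le (C := Fin c) hr hcard hp' hv (by rwa [Fintype.card_fin])
  have hvar : variance (fun ω => (H.monochromaticCount (fun v => X v ω) : ℝ)) P =
      𝔼 x : S → Fin c, (monoCount A x : ℝ) ^ 2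
        - (𝔼 x : S → Fin c, (monoCount A x : ℝ)) ^ 2 := by
    rw [variance_eq_sub hLp, ← hE fun m => (m : ℝ) ^ 2, ← hE fun m => (m : ℝ)]
    rfl
  rw [← hvar] at hoverlap
  rw [hprob, hprob, hmean]
  refine (abs_succ_mul_expect_sub_le (C := Fin c) hr hcard hp' hv hmax k).trans ?_
  unfold defect
  gcongr

end Hypergraph

lemma tendsto_defect (r : ℕ) {p m s : ℕ → ℝ} {l : ℝ} (hp : Tendsto p atTop (𝓝 0))
    (hm : Tendsto m atTop (𝓝 l)) (hs : Tendsto s atTop (𝓝 l)) :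
    Tendsto (fun n => defect r (p n) (m n) (s n)) atTop (𝓝 0) := by
  have hpm : Tendsto (fun n => p n * m n) atTop (𝓝 0) := by simpa using hp.mul hm
  have ho : Tendsto (fun n => 2 * (s n - m n + p n * m n)) atTop (𝓝 0) := by
    simpa using ((hs.sub hm).add hpm).const_mul 2
  have hsq : Tendsto (fun n => √(p n * m n + 2 * (s n - m n + p n * m n))) atTop (𝓝 0) := by
    simpa using (hpm.add ho).sqrt
  simpa [defect] using (hpm.add (ho.const_mul 2)).add ((hm.const_mul (2 * (r : ℝ) ^ 2)).mul hsq)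

end RandomColoring

open MeasureTheory ProbabilityTheory Filter Topology NNReal in
theorem theorem1p1 (r : ℕ) (hr : 2 ≤ r)
    {V : ℕ → Type*} (H : (n : ℕ) → Hypergraph (V n))
    (hfin : ∀ n, (H n).edgeSet.Finite) (hunif : ∀ n, (H n).IsUniformOfRank r)
    (c : ℕ → ℕ) (hc : Tendsto c atTop atTop)
    {Ω : ℕ → Type*} [∀ n, MeasurableSpace (Ω n)]
    (P : (n : ℕ) → Measure (Ω n)) [∀ n, IsProbabilityMeasure (P n)]
    (X : (n : ℕ) → (H n).vertexSet → Ω n → Fin (c n))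
    (hX : ∀ n, (H n).IsUniformRandomColoring (c n) (P n) (X n))
    (T : (n : ℕ) → Ω n → ℝ)
    (hT : ∀ n ω, T n ω = ((H n).monochromaticCount (fun v => X n v ω) : ℝ))
    (lam : ℝ≥0)
    (hmean : Tendsto (fun n => ∫ ω, T n ω ∂(P n)) atTop (𝓝 (lam : ℝ)))
    (hvar : Tendsto (fun n => variance (T n) (P n)) atTop (𝓝 (lam : ℝ))) :
    TendstoInDistribution T atTop (fun k : ℕ => (k : ℝ)) P (poissonMeasure lam) := by
  obtain rfl : T = fun n ω => ((H n).monochromaticCount (fun v => X n v ω) : ℝ) :=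
    funext fun n => funext (hT n)
  have hp : Tendsto (fun n => ((c n : ℝ) ^ (r - 1))⁻¹) atTop (𝓝 0) :=
    tendsto_inv_atTop_zero.comp ((tendsto_pow_atTop (by omega)).comp
      (tendsto_natCast_atTop_atTop.comp hc))
  refine RandomColoring.tendstoInDistribution_poissonMeasure_of_recursion (M := lam + 1)
    (fun n => RandomColoring.measurable_monochromaticCount (hfin n) (hunif n) (hX n))
    (fun n => (RandomColoring.memLp_monochromaticCount (hfin n) (hunif n) (hX n)).integrable
      (by norm_num))
    ((hmean.eventually (gt_mem_nhds (lt_add_one _))).mono fun n hn => hn.le) fun k => ?_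
  have h1 : Tendsto (fun n =>
      (k + 1) * (P n).real {ω | (H n).monochromaticCount (fun v => X n v ω) = k + 1}
      - (∫ ω, ((H n).monochromaticCount (fun v => X n v ω) : ℝ) ∂(P n))
        * (P n).real {ω | (H n).monochromaticCount (fun v => X n v ω) = k}) atTop (𝓝 0) :=
    squeeze_zero_norm' ((hc.eventually_ge_atTop 2).mono fun n hn =>
    RandomColoring.abs_succ_mul_real_sub_le hr (hfin n) (hunif n) (hX n) hn k)
    (RandomColoring.tendsto_defect r hp hmean hvar)
  -- The mean in the recursion may be replaced by its limit, since probabilities are at most 1.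
  have h2 : Tendsto (fun n => ((∫ ω, ((H n).monochromaticCount (fun v => X n v ω) : ℝ) ∂(P n))
      - lam) * (P n).real {ω | (H n).monochromaticCount (fun v => X n v ω) = k}) atTop (𝓝 0) := by
    refine squeeze_zero_norm (fun n => ?_) (tendsto_iff_norm_sub_tendsto_zero.1 hmean)
    rw [norm_mul, Real.norm_of_nonneg (measureReal_nonneg (μ := P n))]
    exact mul_le_of_le_one_right (norm_nonneg _) measureReal_le_one
  have h3 := h1.add h2
  rw [add_zero] at h3
  refine h3.congr fun n => ?_
  ring
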